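/- Let $d\ge 1$, let $\phi:\mathbb R^d\to\mathbb R$ be continuously differentiable, and let $L>0$, $\tau\ge 0$ be such that $\|\nabla\phi(x)-\nabla\phi(y)\|\le L\|x-y\|$ and $\phi(y)\ge\phi(x)+\langle\nabla\phi(x),y-x\rangle+\frac{\tau}{2}\|y-x\|^2$ for all $x,y\in\mathbb R^d$. Let $x^*$ be the global minimizer of $\phi$, let $F=\phi+\varepsilon$, and suppose that $|\varepsilon(x)|\le\beta\|x-x^*\|^2$ for all $x\in\mathbb R^d$, where $\beta>0$ satisfies $$\beta\sqrt{2L^2\pi+\beta^2}<\frac{\pi}{32d}\cdot\frac{8\tau^2L}{48L+3\tau}.$$ Let $\xi_1,\dots,\xi_d$ be orthonormal vectors in $\mathbb R^d$, and let $M\ge 2$ be an integer with $\left(\frac{16M}{e}\right)^M\ge\frac{\pi}{48\sqrt2\,L^2}$. Let $v_1,\dots,v_M$ be the roots of the $M$-th (physicists') Hermite polynomial and $w_1,\dots,w_M$ the Gauss–Hermite weights, $w_m=\int_{\mathbb R}e^{-s^2}\prod_{k\ne m}\frac{s-v_k}{v_m-v_k}\,ds$. For $\sigma>0$ define the Gauss–Hermite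 estimator of the directional Gaussian smoothing (DGS) gradient of $F$ by $$\widetilde\nabla^M_{\sigma}[F](x)=\sum_{i=1}^d\left(\frac{1}{\sqrt\pi\,\sigma}\sum_{m=1}^M w_m\,F(x+\sqrt2\,\sigma v_m\xi_i)\,\sqrt2\,v_m\right)\xi_i.$$ Put $$\rho=\left(1-\frac{\tau}{32L}\right)+\left(\frac{6}{\tau L}+\frac{3}{8L^2}\right)\frac{d\beta\sqrt{2L^2\pi+\beta^2}}{\pi}.$$ Let $x_0\in\mathbb R^d$, let $\tilde r_0>0$ satisfy $\tilde r_0\ge\|x_0-x^*\|$, and let $$x_{t+1}=x_t-\frac{1}{16L}\,\widetilde\nabla^M_{\sigma_t}[F](x_t),\qquad \sigma_t=\frac{\sqrt\beta}{\sqrt[4]{8L^2\pi+4\beta^2}}\,\rho^{t/2}\,\tilde r_0\qquad(t\ge 0).$$ Then $0<\rho<1$, and $x_t$ converges linearly to $x^*$: $$\|x_t-x^*\|^2\le\rho^t\,\tilde r_0^2\quad\text{for all }t\ge 0,\qquad\text{and } x_t\to x^*.$$ -/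

import Mathlib

namespace DGS

/-- The physicists' Hermite polynomial `H_n(v) = 2^{n/2} He_n(√2 v)`, where `He_n` is the
probabilists' Hermite polynomial `Polynomial.hermite n`. It is the orthogonal polynomial for the
weight `exp (-v ^ 2)`. -/
noncomputable def physHermite (n : ℕ) : Polynomial ℝ :=
  Polynomial.C (Real.sqrt 2 ^ n) *
    ((Polynomial.hermite n).map (Int.castRingHom ℝ)).comp
      (Polynomial.C (Real.sqrt 2) * Polynomial.X)

/-- The Gauss–Hermite nodes of order `M`: the (real, simple) roots of `H_M`. -/
noncomputable def ghNodes (M : ℕ) : Finset ℝ :=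
  (physHermite M).roots.toFinset

/-- The Gauss–Hermite quadrature weight of the node `v`: the integral against `exp (-s ^ 2)` of the
Lagrange basis polynomial that is `1` at `v` and `0` at the other nodes. -/
noncomputable def ghWeight (M : ℕ) (v : ℝ) : ℝ :=
  ∫ s : ℝ, Real.exp (-s ^ 2) * (Lagrange.basis (ghNodes M) id v).eval s

/-- The Gauss–Hermite estimator with `M` nodes, at smoothing radius `σ`, of the derivative at `0` of
the one-dimensional Gaussian smoothing of `F` through `x` in the direction `ξ`. -/
noncomputable def ghDeriv {d : ℕ} (M : ℕ) (σ : ℝ) (F : EuclideanSpace ℝ (Fin d) → ℝ)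
    (x ξ : EuclideanSpace ℝ (Fin d)) : ℝ :=
  1 / (Real.sqrt Real.pi * σ) *
    ∑ v ∈ ghNodes M,
      ghWeight M v * F (x + (Real.sqrt 2 * σ * v) • ξ) * (Real.sqrt 2 * v)

/-- The Gauss–Hermite estimator of the directional-Gaussian-smoothing gradient of `F` at `x` along
the directions `ξ 1, …, ξ d`: the vector whose component along `ξ i` is the estimated smoothed
directional derivative. -/
noncomputable def dgsGrad {d : ℕ} (M : ℕ) (σ : ℝ) (ξ : Fin d → EuclideanSpace ℝ (Fin d))
    (F : EuclideanSpace ℝ (Fin d) → ℝ) (x : EuclideanSpace ℝ (Fin d)) :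
    EuclideanSpace ℝ (Fin d) :=
  ∑ i, ghDeriv M σ F x (ξ i) • ξ i

/-- The contraction factor `ρ`. -/
noncomputable def rate (d : ℕ) (L τ β : ℝ) : ℝ :=
  (1 - τ / (32 * L)) +
    (6 / (τ * L) + 3 / (8 * L ^ 2)) *
      (d * β * Real.sqrt (2 * L ^ 2 * Real.pi + β ^ 2) / Real.pi)

end DGS

/-! The iteration is gradient descent for `φ` with an inexact gradient, so everything rests on the
size of the gradient error. Gauss–Hermite quadrature has nonnegative weights and exact moments up to
degree 2, and its fourth moment is at most the Gaussian one. Hence applying it to a function that is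
affine up to `A + B * v ^ 2` recovers the slope up to `(A + B) / σ` (`abs_ghDeriv_sub_le`); no
higher derivatives of `φ` are needed. Curvature contributes order `L * σ` and noise order `β * (‖x -
xstar‖ ^ 2 / σ + σ)`. The prescribed `σ` balances these terms, making the squared error at most `12
* d * β * Q * r ^ 2`, with `Q = √(2 * L ^ 2 * π + β ^ 2)` and `r` the current radius bound
(`error_sq_le`). Strong convexity contracts the squared distance and adds a multiple of this error
(`descent_step`). The sum fits within `ρ * r ^ 2`, and induction closes. -/

namespace DGS

open MeasureTheory Polynomial

/-! ### Gaussian moments of polynomials -/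

/-- Integration of a polynomial against the weight `exp (-s ^ 2)`. -/
noncomputable def gaussInt (p : ℝ[X]) : ℝ :=
  ∫ s : ℝ, Real.exp (-s ^ 2) * p.eval s

theorem integrable_exp_mul_eval (p : ℝ[X]) :
    Integrable fun s : ℝ => Real.exp (-s ^ 2) * p.eval s := by
  induction p using Polynomial.induction_on' with
  | add p q hp hq =>
    simp only [eval_add, mul_add]
    exact hp.add hq
  | monomial n a =>
    have h := integrable_rpow_mul_exp_neg_mul_sq (b := 1) one_pos
      (s := n) (by have : (0 : ℝ) ≤ n := n.cast_nonneg
                   linarith)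
    refine (h.const_mul a).congr (Filter.Eventually.of_forall fun s => ?_)
    simp only [Real.rpow_natCast, eval_monomial, neg_mul, one_mul]
    ring

theorem gaussInt_add (p q : ℝ[X]) : gaussInt (p + q) = gaussInt p + gaussInt q := by
  simp only [gaussInt, eval_add, mul_add]
  exact integral_add (integrable_exp_mul_eval p) (integrable_exp_mul_eval q)

theorem gaussInt_C_mul (a : ℝ) (p : ℝ[X]) : gaussInt (C a * p) = a * gaussInt p := by
  simp only [gaussInt, eval_mul, eval_C, ← integral_const_mul]
  congr 1
  ext s
  ring

theorem gaussInt_sum {ι : Type*} (t : Finset ι) (f : ι → ℝ[X]) :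
    gaussInt (∑ i ∈ t, f i) = ∑ i ∈ t, gaussInt (f i) := by
  simp only [gaussInt, eval_finsetSum, Finset.mul_sum]
  exact integral_finsetSum _ fun i _ => integrable_exp_mul_eval (f i)

/-- The derivative of `exp (-s ^ 2) * p` integrates to zero. This yields the moments and the
orthogonality of Hermite polynomials. -/
theorem gaussInt_derivative (p : ℝ[X]) :
    gaussInt (derivative p) = gaussInt (C 2 * X * p) := by
  have hd : ∀ s : ℝ, HasDerivAt (fun s => Real.exp (-s ^ 2) * p.eval s)
      (Real.exp (-s ^ 2) * (derivative p - C 2 * X * p).eval s) s := by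
    intro s
    have h1 : HasDerivAt (fun s : ℝ => Real.exp (-s ^ 2)) (Real.exp (-s ^ 2) * (-(2 * s))) s := by
      have := ((hasDerivAt_pow 2 s).neg).exp
      simpa using this
    refine (h1.mul (p.hasDerivAt s)).congr_deriv ?_
    simp only [eval_sub, eval_mul, eval_C, eval_X]
    ring
  have h0 := integral_eq_zero_of_hasDerivAt_of_integrable hd
    (integrable_exp_mul_eval _) (integrable_exp_mul_eval p)
  have h1 : gaussInt (derivative p) =
      gaussInt (derivative p - C 2 * X * p) + gaussInt (C 2 * X * p) := by
    rw [← gaussInt_add, sub_add_cancel]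
  rw [h1, show gaussInt (derivative p - C 2 * X * p) = 0 from h0, zero_add]

theorem gaussInt_one : gaussInt 1 = √Real.pi := by
  have h := integral_gaussian 1
  simpa [gaussInt] using h

theorem gaussInt_X : gaussInt X = 0 := by
  have h := gaussInt_derivative 1
  rw [mul_one, gaussInt_C_mul, derivative_one] at h
  have h0 : gaussInt 0 = 0 := by simp [gaussInt]
  linarith

theorem gaussInt_X_sq : gaussInt (X ^ 2) = √Real.pi / 2 := by
  have h := gaussInt_derivative X
  rw [mul_assoc, ← sq, gaussInt_C_mul, derivative_X, gaussInt_one] at h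
  linarith

theorem gaussInt_X_pow_four : gaussInt (X ^ 4) = 3 * √Real.pi / 4 := by
  have h := gaussInt_derivative (X ^ 3)
  rw [mul_assoc, ← pow_succ', gaussInt_C_mul, derivative_X_pow, gaussInt_C_mul] at h
  norm_num [gaussInt_X_sq] at h
  linarith

theorem gaussInt_pos {p : ℝ[X]} (hp : p ≠ 0) (hnn : ∀ s, 0 ≤ p.eval s) : 0 < gaussInt p := by
  obtain ⟨a, ha⟩ : ∃ a, p.eval a ≠ 0 := by
    by_contra! h
    exact hp (Polynomial.funext (by simpa using h))
  exact integral_pos_of_integrable_nonneg_nonzero (x := a) (by fun_prop)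
    (integrable_exp_mul_eval p) (fun s => mul_nonneg (Real.exp_pos _).le (hnn s))
    (mul_ne_zero (Real.exp_pos _).ne' ha)

/-! ### Hermite polynomials: orthogonality and simple real roots -/

theorem physHermite_succ (n : ℕ) :
    physHermite (n + 1) = C 2 * X * physHermite n - derivative (physHermite n) := by
  have h2 : (C √2 * C √2 : ℝ[X]) = C 2 := by
    rw [← C_mul, Real.mul_self_sqrt (by norm_num)]
  simp only [physHermite, hermite_succ, Polynomial.map_sub, Polynomial.map_mul, map_X, sub_comp,
    mul_comp, X_comp, derivative_mul, derivative_C, derivative_comp, derivative_map,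
    derivative_X, zero_mul, zero_add, mul_one, pow_succ, C_mul]
  rw [← h2]
  ring

/-- Passing from `H_n` to `H_{n+1}` is adjoint to differentiation for the Gaussian weight. -/
theorem gaussInt_physHermite_mul (n : ℕ) (q : ℝ[X]) :
    gaussInt (physHermite n * q) = gaussInt (derivative^[n] q) := by
  induction n generalizing q with
  | zero => simp [physHermite]
  | succ n ih =>
    have h := gaussInt_derivative (physHermite n * q)
    have h1 : C 2 * X * (physHermite n * q) =
        physHermite (n + 1) * q + derivative (physHermite n) * q := by
      rw [physHermite_succ]; ring
    rw [h1, derivative_mul, gaussInt_add, gaussInt_add] at h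
    rw [Function.iterate_succ_apply, ← ih]
    linarith

theorem gaussInt_physHermite_mul_eq_zero {n : ℕ} {q : ℝ[X]} (hq : q.degree < n) :
    gaussInt (physHermite n * q) = 0 := by
  rw [gaussInt_physHermite_mul]
  have : derivative^[n] q = 0 := by
    by_cases h : q = 0
    · simp [h]
    · exact iterate_derivative_eq_zero ((natDegree_lt_iff_degree_lt h).2 hq)
  simp [this, gaussInt]

theorem natDegree_physHermite (n : ℕ) : (physHermite n).natDegree = n := by
  have hs : √(2 : ℝ) ≠ 0 := by positivity
  rw [physHermite, natDegree_C_mul (pow_ne_zero _ hs), natDegree_comp, natDegree_C_mul_X _ hs,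
    (hermite_monic n).natDegree_map, natDegree_hermite, mul_one]

theorem physHermite_ne_zero (n : ℕ) : physHermite n ≠ 0 := by
  intro h
  cases n with
  | zero => simp [physHermite] at h
  | succ n => simpa [h] using natDegree_physHermite (n + 1)

/-- No nonconstant nonnegative polynomial divides a Hermite polynomial. -/
theorem not_dvd_physHermite {n : ℕ} {h : ℝ[X]} (hdeg : 0 < h.natDegree)
    (hnn : ∀ s, 0 ≤ h.eval s) : ¬ h ∣ physHermite n := by
  rintro ⟨g, hg⟩
  have hne := physHermite_ne_zero n
  have hg0 : g ≠ 0 := by rintro rfl; simp [hne] at hg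
  have hh0 : h ≠ 0 := by rintro rfl; simp at hdeg
  have hd := natDegree_physHermite n
  rw [hg, natDegree_mul hh0 hg0] at hd
  -- The cofactor `g` has degree below `n`, so orthogonality applies; yet the integrand is `h * g ^
  -- 2`, whose integral is positive.
  have h0 : gaussInt (physHermite n * g) = 0 :=
    gaussInt_physHermite_mul_eq_zero ((natDegree_lt_iff_degree_lt hg0).1 (by omega))
  refine (gaussInt_pos (mul_ne_zero (hg ▸ hne) hg0) fun s => ?_).ne' h0
  rw [hg, eval_mul, eval_mul, mul_assoc]
  exact mul_nonneg (hnn s) (mul_self_nonneg _)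

theorem nodup_roots_physHermite (n : ℕ) : (physHermite n).roots.Nodup := by
  classical
  rw [Multiset.nodup_iff_count_le_one]
  intro a
  rw [count_roots]
  by_contra! hlt
  have hdvd := (le_rootMultiplicity_iff (physHermite_ne_zero n)).1 (show 2 ≤ _ from hlt)
  refine not_dvd_physHermite ?_ (fun s => ?_) hdvd
  · rw [natDegree_pow, natDegree_X_sub_C]; norm_num
  · simp only [eval_pow]; positivity

/-- If real roots were missing, the rootless cofactor would have a nonreal root, hence a nonnegative
real quadratic factor. -/
theorem card_roots_physHermite (n : ℕ) : (physHermite n).roots.card = n := by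
  obtain ⟨q, hq, hcard, hroots⟩ := exists_prod_multiset_X_sub_C_mul (physHermite n)
  rw [natDegree_physHermite] at hcard
  have hq0 : q ≠ 0 := by
    rintro rfl
    exact physHermite_ne_zero n (by simpa using hq.symm)
  rcases Nat.eq_zero_or_pos q.natDegree with h | h
  · omega
  exfalso
  obtain ⟨z, hz⟩ := Complex.exists_root (f := q.map (algebraMap ℝ ℂ)) (by
    rw [degree_map]; exact natDegree_pos_iff_degree_pos.1 h)
  have hz' : aeval z q = 0 := by rwa [IsRoot, eval_map_algebraMap] at hz
  by_cases him : z.im = 0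
  · have : z = (z.re : ℂ) := by apply Complex.ext <;> simp [him]
    rw [this] at hz'
    have h1 : q.eval z.re = 0 := by
      have := hz'
      rw [show ((z.re : ℝ) : ℂ) = algebraMap ℝ ℂ z.re from rfl, aeval_algebraMap_apply] at this
      simpa using this
    have : z.re ∈ q.roots := (mem_roots hq0).2 h1
    simp [hroots] at this
  · have hd := quadratic_dvd_of_aeval_eq_zero_im_ne_zero q hz' him
    refine not_dvd_physHermite (n := n) ?_ (fun s => ?_) (hd.trans ⟨_, by rw [mul_comm, hq]⟩)
    · have : (X ^ 2 - C (2 * z.re) * X + C (‖z‖ ^ 2) : ℝ[X]).natDegree = 2 := by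
        compute_degree!
      omega
    · have : ‖z‖ ^ 2 = z.re ^ 2 + z.im ^ 2 := by
        rw [Complex.sq_norm, Complex.normSq_apply]; ring
      simp only [eval_add, eval_sub, eval_mul, eval_pow, eval_X, eval_C, this]
      nlinarith [sq_nonneg (s - z.re), sq_nonneg z.im]

theorem card_ghNodes (M : ℕ) : (ghNodes M).card = M := by
  rw [ghNodes, Multiset.toFinset_card_of_nodup (nodup_roots_physHermite M),
    card_roots_physHermite]

theorem eval_physHermite_of_mem {M : ℕ} {v : ℝ} (hv : v ∈ ghNodes M) :
    (physHermite M).eval v = 0 :=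
  isRoot_of_mem_roots (Multiset.mem_toFinset.1 hv)

/-! ### Gauss–Hermite quadrature -/

/-- Gauss–Hermite quadrature with `M` nodes is exact on polynomials of degree below `2 * M`. -/
theorem sum_ghWeight_mul_eval {M : ℕ} {p : ℝ[X]} (hp : p.degree < (2 * M : ℕ)) :
    ∑ v ∈ ghNodes M, ghWeight M v * p.eval v = gaussInt p := by
  have hH := physHermite_ne_zero M
  have hdM : (physHermite M).degree = M := by
    rw [degree_eq_natDegree hH, natDegree_physHermite]
  -- The quotient term vanishes at the nodes and integrates to zero; the remainder is interpolated
  -- exactly.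
  have hsplit : physHermite M * (p / physHermite M) + p % physHermite M = p :=
    EuclideanDomain.div_add_mod p _
  have hr : (p % physHermite M).degree < (ghNodes M).card := by
    rw [card_ghNodes, ← hdM]; exact EuclideanDomain.mod_lt p hH
  have hq : (p / physHermite M).degree < M := by
    rcases lt_or_ge p.degree (physHermite M).degree with h | h
    · rw [(Polynomial.div_eq_zero_iff hH).2 h, degree_zero]
      exact WithBot.bot_lt_coe _
    · have hadd := degree_add_div hH h
      rw [hdM] at hadd
      rw [← hadd, two_mul, Nat.cast_add] at hp
      exact lt_of_add_lt_add_left hp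
  have hev : ∀ v ∈ ghNodes M, p.eval v = (p % physHermite M).eval v := by
    intro v hv
    conv_lhs => rw [← hsplit]
    rw [eval_add, eval_mul, eval_physHermite_of_mem hv, zero_mul, zero_add]
  have hint := Lagrange.eq_interpolate (s := ghNodes M) (v := id)
    (Set.injOn_id _) hr
  conv_rhs => rw [← hsplit, gaussInt_add, gaussInt_physHermite_mul_eq_zero hq, zero_add, hint,
    Lagrange.interpolate_apply, gaussInt_sum]
  refine Finset.sum_congr rfl fun v hv => ?_
  rw [gaussInt_C_mul, hev v hv, mul_comm]
  rfl

/-- The squared Lagrange basis polynomial has degree `2 * M - 2`, so its nonnegative integral is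
exactly the weight. -/
theorem ghWeight_nonneg {M : ℕ} {v : ℝ} (hv : v ∈ ghNodes M) : 0 ≤ ghWeight M v := by
  have hM : 0 < M := by
    rw [← card_ghNodes M]; exact Finset.card_pos.2 ⟨v, hv⟩
  have hb0 := Lagrange.basis_ne_zero (Set.injOn_id (ghNodes M : Set ℝ)) hv
  have hd : ((Lagrange.basis (ghNodes M) id v) ^ 2).degree < (2 * M : ℕ) := by
    rw [← natDegree_lt_iff_degree_lt (pow_ne_zero 2 hb0), natDegree_pow,
      Lagrange.natDegree_basis (Set.injOn_id _) hv, card_ghNodes]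
    omega
  have h := sum_ghWeight_mul_eval hd
  rw [Finset.sum_eq_single_of_mem v hv] at h
  · have h1 : (Lagrange.basis (ghNodes M) id v).eval v = 1 :=
      Lagrange.eval_basis_self (Set.injOn_id _) hv
    rw [eval_pow, h1, one_pow, mul_one] at h
    rw [h]
    exact integral_nonneg fun s => mul_nonneg (Real.exp_pos _).le (by
      rw [eval_pow]; exact sq_nonneg _)
  · intro u hu huv
    have h1 : (Lagrange.basis (ghNodes M) id v).eval u = 0 :=
      Lagrange.eval_basis_of_ne (v := id) huv.symm hu
    rw [eval_pow, h1]
    simp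

theorem sum_ghWeight {M : ℕ} (hM : 1 ≤ M) : ∑ v ∈ ghNodes M, ghWeight M v = √Real.pi := by
  have h := sum_ghWeight_mul_eval (M := M) (p := 1) (by
    rw [degree_one]; exact_mod_cast (by omega : 0 < 2 * M))
  simpa [gaussInt_one] using h

theorem sum_ghWeight_mul_self {M : ℕ} (hM : 1 ≤ M) :
    ∑ v ∈ ghNodes M, ghWeight M v * v = 0 := by
  have h := sum_ghWeight_mul_eval (M := M) (p := X) (by
    rw [degree_X]; exact_mod_cast (by omega : 1 < 2 * M))
  simpa [gaussInt_X] using h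

theorem sum_ghWeight_mul_sq {M : ℕ} (hM : 2 ≤ M) :
    ∑ v ∈ ghNodes M, ghWeight M v * v ^ 2 = √Real.pi / 2 := by
  have h := sum_ghWeight_mul_eval (M := M) (p := X ^ 2) (by
    rw [degree_X_pow]; exact_mod_cast (by omega : 2 < 2 * M))
  simpa [gaussInt_X_sq] using h

/-- Only `M = 2` lies outside the exactness range; there both nodes satisfy `v ^ 2 = 1 / 2`. -/
theorem sum_ghWeight_mul_pow_four_le {M : ℕ} (hM : 2 ≤ M) :
    ∑ v ∈ ghNodes M, ghWeight M v * v ^ 4 ≤ 3 * √Real.pi / 4 := by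
  rcases hM.eq_or_lt with rfl | hM
  · have h : ∀ v ∈ ghNodes 2, ghWeight 2 v * v ^ 4 = ghWeight 2 v * v ^ 2 * (1 / 2) := by
      intro v hv
      have h2 := eval_physHermite_of_mem hv
      rw [physHermite_succ, physHermite_succ] at h2
      simp [physHermite] at h2
      have : v ^ 2 = 1 / 2 := by nlinarith
      rw [show v ^ 4 = v ^ 2 * v ^ 2 by ring, this]; ring
    rw [Finset.sum_congr rfl h, ← Finset.sum_mul, sum_ghWeight_mul_sq le_rfl]
    nlinarith [Real.sqrt_nonneg Real.pi]
  · have h := sum_ghWeight_mul_eval (M := M) (p := X ^ 4) (by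
      rw [degree_X_pow]; exact_mod_cast (by omega : 4 < 2 * M))
    simpa [gaussInt_X_pow_four] using h.le

end DGS

namespace DGS

/-! ### From quadrature to the gradient estimator -/

/-- If `F` agrees along the line through `x` with an affine function up to `A + B * v ^ 2` at the
nodes, then the Gauss–Hermite estimator recovers its slope up to `(A + B) / σ`. -/
theorem abs_ghDeriv_sub_le {d M : ℕ} (hM : 2 ≤ M) {σ : ℝ} (hσ : 0 < σ)
    {F : EuclideanSpace ℝ (Fin d) → ℝ} {x ξ : EuclideanSpace ℝ (Fin d)} {c D A B : ℝ}
    (hA : 0 ≤ A) (hB : 0 ≤ B)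
    (h : ∀ v : ℝ, |F (x + (√2 * σ * v) • ξ) - c - √2 * σ * v * D| ≤ A + B * v ^ 2) :
    |ghDeriv M σ F x ξ - D| ≤ (A + B) / σ := by
  have hπ : 0 < √Real.pi := Real.sqrt_pos.2 Real.pi_pos
  have h2 : √2 * √2 = (2 : ℝ) := Real.mul_self_sqrt (by norm_num)
  have s0 := sum_ghWeight (M := M) (by omega)
  have s1 := sum_ghWeight_mul_self (M := M) (by omega)
  have s2 := sum_ghWeight_mul_sq hM
  have s4 := sum_ghWeight_mul_pow_four_le hM
  have hsum : ∑ v ∈ ghNodes M, ghWeight M v * F (x + (√2 * σ * v) • ξ) * (√2 * v) =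
      ∑ v ∈ ghNodes M, ghWeight M v *
        ((F (x + (√2 * σ * v) • ξ) - c - √2 * σ * v * D) * (√2 * v)) + √Real.pi * σ * D := by
    have : ∀ v ∈ ghNodes M, ghWeight M v * F (x + (√2 * σ * v) • ξ) * (√2 * v) =
        ghWeight M v * ((F (x + (√2 * σ * v) • ξ) - c - √2 * σ * v * D) * (√2 * v)) +
        (c * √2 * (ghWeight M v * v) + 2 * σ * D * (ghWeight M v * v ^ 2)) := by
      intro v _
      linear_combination (ghWeight M v * σ * D * v ^ 2) * h2
    rw [Finset.sum_congr rfl this, Finset.sum_add_distrib, Finset.sum_add_distrib,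
      ← Finset.mul_sum, ← Finset.mul_sum, s1, s2]
    ring
  have hbound : |∑ v ∈ ghNodes M, ghWeight M v *
      ((F (x + (√2 * σ * v) • ξ) - c - √2 * σ * v * D) * (√2 * v))| ≤ √Real.pi * (A + B) := by
    calc _ ≤ ∑ v ∈ ghNodes M, (A / 2 * ghWeight M v + (A + B / 2) * (ghWeight M v * v ^ 2) +
              B * (ghWeight M v * v ^ 4)) := by
          refine (Finset.abs_sum_le_sum_abs _ _).trans (Finset.sum_le_sum fun v hv => ?_)
          have hw := ghWeight_nonneg hv
          -- This leaves only even moments, and `(A + B * v ^ 2) * (1 / 2 + v ^ 2)` has Gaussian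
          -- integral exactly `√π * (A + B)`.
          have hv2 : |√2 * v| ≤ 1 / 2 + v ^ 2 := by
            rw [abs_le]
            constructor <;> nlinarith [sq_nonneg (√2 * v + 1), sq_nonneg (√2 * v - 1)]
          rw [abs_mul, abs_of_nonneg hw, abs_mul]
          have := mul_le_mul_of_nonneg_left
            (mul_le_mul (h v) hv2 (abs_nonneg _) (by positivity)) hw
          linarith
      _ ≤ √Real.pi * (A + B) := by
          rw [Finset.sum_add_distrib, Finset.sum_add_distrib, ← Finset.mul_sum, ← Finset.mul_sum,
            ← Finset.mul_sum, s0, s2]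
          linarith [mul_le_mul_of_nonneg_left s4 hB]
  have heq : ghDeriv M σ F x ξ - D = (∑ v ∈ ghNodes M, ghWeight M v *
      ((F (x + (√2 * σ * v) • ξ) - c - √2 * σ * v * D) * (√2 * v))) / (√Real.pi * σ) := by
    rw [ghDeriv, hsum, one_div_mul_eq_div, add_div, mul_div_cancel_left₀ _ (by positivity),
      add_sub_cancel_right]
  rw [heq, abs_div, abs_of_pos (mul_pos hπ hσ), div_le_div_iff₀ (mul_pos hπ hσ) hσ]
  calc _ ≤ √Real.pi * (A + B) * σ := by gcongr
    _ = _ := by ring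

/-- The `d` directions form an orthonormal basis, so componentwise errors add in squares. -/
theorem norm_dgsGrad_sub_sq_le {d M : ℕ} {σ E : ℝ} {ξ : Fin d → EuclideanSpace ℝ (Fin d)}
    (hξ : Orthonormal ℝ ξ) {F : EuclideanSpace ℝ (Fin d) → ℝ} {x g : EuclideanSpace ℝ (Fin d)}
    (h : ∀ i, |ghDeriv M σ F x (ξ i) - inner ℝ (ξ i) g| ≤ E) :
    ‖dgsGrad M σ ξ F x - g‖ ^ 2 ≤ d * E ^ 2 := by
  have hcard : Fintype.card (Fin d) = Module.finrank ℝ (EuclideanSpace ℝ (Fin d)) := by simp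
  have hspan : ⊤ ≤ Submodule.span ℝ (Set.range ξ) :=
    (hξ.linearIndependent.span_eq_top_of_card_eq_finrank' hcard).ge
  have hg : ∑ i, inner ℝ (ξ i) g • ξ i = g := by
    have := (OrthonormalBasis.mk hξ hspan).sum_repr' g
    simpa using this
  have hsub : dgsGrad M σ ξ F x - g =
      ∑ i, (ghDeriv M σ F x (ξ i) - inner ℝ (ξ i) g) • ξ i := by
    conv_lhs => rw [← hg]
    simp only [dgsGrad, sub_smul, Finset.sum_sub_distrib, hg]
  rw [hsub, ← real_inner_self_eq_norm_sq, hξ.inner_sum]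
  calc _ ≤ ∑ _i : Fin d, E ^ 2 := by
        refine Finset.sum_le_sum fun i _ => ?_
        have := sq_le_sq' (abs_le.1 (h i)).1 (abs_le.1 (h i)).2
        simpa [sq] using this
    _ = _ := by simp

/-! ### Gradient descent with an inexact gradient -/

section StronglyConvex

variable {V : Type*} [NormedAddCommGroup V] [InnerProductSpace ℝ V] {φ : V → ℝ} {g : V → V}
  {L τ : ℝ}

/-- Convexity at `y` and Cauchy–Schwarz avoid integrating along the segment, at the cost of `L` in
place of `L / 2`. -/
theorem taylor_upper_bound (hL : ∀ x y, ‖g x - g y‖ ≤ L * ‖x - y‖)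
    (hconv : ∀ x y, φ x + inner ℝ (g x) (y - x) ≤ φ y) (x y : V) :
    φ y ≤ φ x + inner ℝ (g x) (y - x) + L * ‖y - x‖ ^ 2 := by
  have h1 := hconv y x
  have h2 : inner ℝ (g y - g x) (y - x) ≤ L * ‖y - x‖ ^ 2 := by
    refine (real_inner_le_norm _ _).trans ?_
    have := mul_le_mul_of_nonneg_right (hL y x) (norm_nonneg (y - x))
    rwa [mul_assoc, ← sq] at this
  rw [inner_sub_left] at h2
  rw [← neg_sub y x, inner_neg_right] at h1
  linarith

/-- Compare the minimum with the value after a gradient step of size `1 / (2 * L)`, which minimizes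
the preceding upper bound. -/
theorem norm_gradient_sq_le (hL0 : 0 < L) (hL : ∀ x y, ‖g x - g y‖ ≤ L * ‖x - y‖)
    (hconv : ∀ x y, φ x + inner ℝ (g x) (y - x) ≤ φ y) {xstar : V}
    (hmin : ∀ x, φ xstar ≤ φ x) (x : V) :
    ‖g x‖ ^ 2 ≤ 4 * L * (φ x - φ xstar) := by
  have h := (hmin _).trans (taylor_upper_bound hL hconv x (x - (1 / (2 * L)) • g x))
  rw [sub_sub_cancel_left, inner_neg_right, inner_smul_right, real_inner_self_eq_norm_sq, norm_neg,
    norm_smul, mul_pow, Real.norm_eq_abs, sq_abs] at h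
  have h2 : L * ((1 / (2 * L)) ^ 2 * ‖g x‖ ^ 2) = ‖g x‖ ^ 2 / (4 * L) := by
    field_simp; ring
  have h3 : 1 / (2 * L) * ‖g x‖ ^ 2 = 2 * (‖g x‖ ^ 2 / (4 * L)) := by
    field_simp; ring
  rw [h2, h3] at h
  rw [← div_le_iff₀' (by positivity)]
  linarith

theorem modulus_le (hconv : ∀ x y, φ x + inner ℝ (g x) (y - x) + τ / 2 * ‖y - x‖ ^ 2 ≤ φ y)
    (hL : ∀ x y, ‖g x - g y‖ ≤ L * ‖x - y‖) [Nontrivial V] : τ ≤ L := by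
  obtain ⟨x, y, hxy⟩ := exists_pair_ne V
  have hpos : 0 < ‖y - x‖ := norm_pos_iff.2 (sub_ne_zero.2 hxy.symm)
  have h1 := hconv x y
  have h2 := hconv y x
  have h3 : inner ℝ (g y - g x) (y - x) ≤ L * ‖y - x‖ ^ 2 := by
    refine (real_inner_le_norm _ _).trans ?_
    have := mul_le_mul_of_nonneg_right (hL y x) (norm_nonneg (y - x))
    rwa [mul_assoc, ← sq] at this
  rw [inner_sub_left] at h3
  rw [← neg_sub y x, inner_neg_right, norm_neg] at h2
  have : τ * ‖y - x‖ ^ 2 ≤ L * ‖y - x‖ ^ 2 := by linarith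
  exact le_of_mul_le_mul_right this (by positivity)

/-- One step of gradient descent with step size `1 / (16 * L)` and an inexact gradient. -/
theorem descent_step (hL0 : 0 < L) (hτ : 0 < τ) (hL : ∀ x y, ‖g x - g y‖ ≤ L * ‖x - y‖)
    (hconv : ∀ x y, φ x + inner ℝ (g x) (y - x) + τ / 2 * ‖y - x‖ ^ 2 ≤ φ y) {xstar : V}
    (hmin : ∀ x, φ xstar ≤ φ x) (x G : V) :
    ‖x - (1 / (16 * L)) • G - xstar‖ ^ 2 ≤ (1 - τ / (32 * L)) * ‖x - xstar‖ ^ 2 +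
      (1 / (20 * τ * L) + 1 / (128 * L ^ 2)) * ‖G - g x‖ ^ 2 := by
  have hconv' : ∀ x y, φ x + inner ℝ (g x) (y - x) ≤ φ y := fun x y => by
    have := hconv x y
    have h2 : 0 ≤ τ / 2 * ‖y - x‖ ^ 2 := by positivity
    linarith
  have hK := norm_gradient_sq_le hL0 hL hconv' hmin x
  have hgs : g xstar = 0 := by
    have := norm_gradient_sq_le hL0 hL hconv' hmin xstar
    rw [sub_self, mul_zero] at this
    exact norm_eq_zero.1 (pow_eq_zero_iff two_ne_zero |>.1 (le_antisymm this (sq_nonneg _)))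
  have hKa := hconv xstar x
  rw [hgs, inner_zero_left] at hKa
  have hP := hconv x xstar
  rw [← neg_sub x xstar, inner_neg_right, norm_neg] at hP
  obtain ⟨e, he⟩ : ∃ e, G = g x + e := ⟨G - g x, by abel⟩
  have hGe : G - g x = e := by rw [he]; abel
  rw [hGe]
  set u := x - xstar
  set η := 1 / (16 * L) with hη
  have hη0 : 0 < η := by positivity
  have hηL : η * L = 1 / 16 := by rw [hη]; field_simp
  have hexp : ‖x - η • G - xstar‖ ^ 2 =
      ‖u‖ ^ 2 - 2 * η * (inner ℝ (g x) u + inner ℝ e u) + η ^ 2 * ‖g x + e‖ ^ 2 := by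
    rw [show x - η • G - xstar = u - η • (g x + e) by rw [he]; simp only [u]; abel,
      norm_sub_sq_real, inner_smul_right, norm_smul, mul_pow, Real.norm_eq_abs, sq_abs,
      real_inner_comm, inner_add_left]
    ring
  have hsum : ‖g x + e‖ ^ 2 ≤ 2 * ‖g x‖ ^ 2 + 2 * ‖e‖ ^ 2 := by
    have := parallelogram_law_with_norm ℝ (g x) e
    nlinarith [mul_self_nonneg ‖g x - e‖]
  -- The weight `5 / 4` is forced by the bookkeeping: in units of `η * τ * ‖u‖ ^ 2`, strong
  -- convexity gives `-1`, the remaining function gap gives `-3 / 4`, and the target is `-1 / 2`.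
  have hyoung : -(2 * inner ℝ e u) ≤ 5 / 4 * τ * ‖u‖ ^ 2 + 4 / (5 * τ) * ‖e‖ ^ 2 := by
    have h1 : -(inner ℝ e u) ≤ ‖e‖ * ‖u‖ := by
      have := abs_real_inner_le_norm e u
      linarith [neg_abs_le (inner ℝ e u)]
    have h2 : 5 / 4 * τ * ‖u‖ ^ 2 + 4 / (5 * τ) * ‖e‖ ^ 2 - 2 * (‖e‖ * ‖u‖) =
        4 / (5 * τ) * (‖e‖ - 5 / 4 * τ * ‖u‖) ^ 2 := by
      field_simp
      ring
    have h3 : 0 ≤ 4 / (5 * τ) * (‖e‖ - 5 / 4 * τ * ‖u‖) ^ 2 := by positivity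
    linarith
  have hgrad : η ^ 2 * (2 * ‖g x‖ ^ 2) ≤ η / 2 * (φ x - φ xstar) := by
    have := mul_le_mul_of_nonneg_left hK (by positivity : 0 ≤ 2 * η ^ 2)
    have h2 : 2 * η ^ 2 * (4 * L * (φ x - φ xstar)) = η / 2 * (φ x - φ xstar) := by
      linear_combination (8 * η * (φ x - φ xstar)) * hηL
    linarith
  have c1 : τ / (32 * L) = η * τ / 2 := by rw [hη]; field_simp; norm_num
  have c2 : 1 / (20 * τ * L) + 1 / (128 * L ^ 2) = η * (4 / (5 * τ)) + 2 * η ^ 2 := by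
    rw [hη]; field_simp; ring
  rw [hexp, c1, c2]
  have m1 := mul_le_mul_of_nonneg_left hyoung hη0.le
  have m2 := mul_le_mul_of_nonneg_left hsum (sq_nonneg η)
  have m3 := mul_le_mul_of_nonneg_left hP hη0.le
  have m4 := mul_le_mul_of_nonneg_left hKa hη0.le
  linarith

end StronglyConvex

/-! ### Balancing curvature and noise -/

/-- The smoothing radius is tuned so that the squared gradient error is of order
`β * √(2 * L ^ 2 * π + β ^ 2) * r ^ 2`. -/
theorem error_sq_le {L β r σ a Q : ℝ} (hL : 0 < L) (hβ : 0 < β) (hβL : β ≤ L / 20)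
    (hσ : 0 < σ) (hQ : 5 / 2 * L ≤ Q) (hσr : σ ^ 2 * (2 * Q) = β * r ^ 2)
    (har : a ^ 2 ≤ r ^ 2) :
    ((2 * β * a ^ 2 + (2 * L * σ ^ 2 + 4 * β * σ ^ 2)) / σ) ^ 2 ≤ 12 * (β * Q) * r ^ 2 := by
  have hQ0 : 0 < Q := by linarith
  -- Here `β * a ^ 2 ≤ 2 * Q * σ ^ 2` and `2 * L + 4 * β ≤ 0.88 * Q`, totalling `4.88 = 122 / 25`;
  -- half its square is below `12`.
  have h1 : (2 * β * a ^ 2 + (2 * L * σ ^ 2 + 4 * β * σ ^ 2)) / σ ≤ 122 / 25 * Q * σ := by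
    rw [div_le_iff₀ hσ]
    have h2 := mul_le_mul_of_nonneg_left har hβ.le
    have h3 : (2 * L + 4 * β) * σ ^ 2 ≤ 22 / 25 * Q * σ ^ 2 := by
      gcongr
      linarith
    nlinarith
  calc _ ≤ (122 / 25 * Q * σ) ^ 2 := by gcongr
    _ = (122 / 25) ^ 2 / 2 * Q * (σ ^ 2 * (2 * Q)) := by ring
    _ = (122 / 25) ^ 2 / 2 * (β * Q * r ^ 2) := by rw [hσr]; ring
    _ ≤ 12 * (β * Q * r ^ 2) := by gcongr; norm_num
    _ = _ := by ring

/-- The effect of quadratically bounded noise on the Gauss–Hermite directional derivative. -/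
theorem abs_ghDeriv_sub_inner_le {d M : ℕ} (hM : 2 ≤ M)
    {φ ε F : EuclideanSpace ℝ (Fin d) → ℝ}
    {g : EuclideanSpace ℝ (Fin d) → EuclideanSpace ℝ (Fin d)} {L β σ : ℝ} (hL : 0 < L)
    (hβ : 0 < β) (hσ : 0 < σ) (hF : ∀ x, F x = φ x + ε x)
    (hLip : ∀ x y, ‖g x - g y‖ ≤ L * ‖x - y‖)
    (hconv : ∀ x y, φ x + inner ℝ (g x) (y - x) ≤ φ y) {xstar : EuclideanSpace ℝ (Fin d)}
    (hε : ∀ x, |ε x| ≤ β * ‖x - xstar‖ ^ 2) (x : EuclideanSpace ℝ (Fin d))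
    {ξ : EuclideanSpace ℝ (Fin d)} (hξ : ‖ξ‖ = 1) :
    |ghDeriv M σ F x ξ - inner ℝ ξ (g x)| ≤
      (2 * β * ‖x - xstar‖ ^ 2 + (2 * L * σ ^ 2 + 4 * β * σ ^ 2)) / σ := by
  refine abs_ghDeriv_sub_le (c := φ x) hM hσ (by positivity) (by positivity) fun v => ?_
  have h2 : √2 * √2 = (2 : ℝ) := Real.mul_self_sqrt (by norm_num)
  set t := √2 * σ * v with ht
  have ht2 : t ^ 2 = 2 * σ ^ 2 * v ^ 2 := by
    rw [ht]; linear_combination (σ ^ 2 * v ^ 2) * h2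
  have hn : ‖t • ξ‖ ^ 2 = t ^ 2 := by
    rw [norm_smul, hξ, mul_one, Real.norm_eq_abs, sq_abs]
  have hlow := hconv x (x + t • ξ)
  have hup := taylor_upper_bound hLip hconv x (x + t • ξ)
  rw [add_sub_cancel_left, inner_smul_right, real_inner_comm] at hlow
  rw [add_sub_cancel_left, inner_smul_right, hn, real_inner_comm] at hup
  have hnoise : |ε (x + t • ξ)| ≤ β * (2 * ‖x - xstar‖ ^ 2 + 2 * t ^ 2) := by
    refine (hε _).trans (mul_le_mul_of_nonneg_left ?_ hβ.le)
    rw [← hn, show x + t • ξ - xstar = (x - xstar) + t • ξ by abel]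
    have := parallelogram_law_with_norm ℝ (x - xstar) (t • ξ)
    nlinarith [mul_self_nonneg ‖x - xstar - t • ξ‖]
  rw [ht2] at hup hnoise
  rw [abs_le] at hnoise ⊢
  rw [hF]
  have hp : 0 ≤ L * (2 * σ ^ 2 * v ^ 2) := by positivity
  constructor <;> linarith [hnoise.1, hnoise.2]

end DGS

/-! ### Linear convergence -/

theorem theorem4p3 (d : ℕ) (hd : 0 < d)
    (φ ε F : EuclideanSpace ℝ (Fin d) → ℝ) (L τ β : ℝ)
    (hF : ∀ x, F x = φ x + ε x)
    -- `φ` is `C¹` with `L`-Lipschitz gradient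
    (hL : 0 < L) (hφ : ContDiff ℝ 1 φ)
    (hLip : ∀ x y, ‖gradient φ x - gradient φ y‖ ≤ L * ‖x - y‖)
    -- `φ` is strongly convex with parameter `τ`
    (hτ : 0 ≤ τ)
    (hconv : ∀ x y, φ x + inner ℝ (gradient φ x) (y - x) + τ / 2 * ‖y - x‖ ^ 2 ≤ φ y)
    -- `xstar` is the global minimizer of `φ`
    (xstar : EuclideanSpace ℝ (Fin d)) (hmin : ∀ x, φ xstar ≤ φ x)
    -- quadratically diminishing noise
    (hβ : 0 < β) (hε : ∀ x, |ε x| ≤ β * ‖x - xstar‖ ^ 2)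
    (hβsmall : β * Real.sqrt (2 * L ^ 2 * Real.pi + β ^ 2) <
      Real.pi / (32 * d) * (8 * τ ^ 2 * L / (48 * L + 3 * τ)))
    -- number of quadrature nodes
    (M : ℕ) (hM2 : 2 ≤ M)
    (hM : Real.pi / (48 * Real.sqrt 2 * L ^ 2) ≤ (16 * (M : ℝ) / Real.exp 1) ^ M)
    -- smoothing directions
    (ξ : Fin d → EuclideanSpace ℝ (Fin d)) (hξ : Orthonormal ℝ ξ)
    -- iterates and smoothing radii
    (x : ℕ → EuclideanSpace ℝ (Fin d)) (r₀ : ℝ) (hr₀pos : 0 < r₀) (hr₀ : ‖x 0 - xstar‖ ≤ r₀)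
    (σ : ℕ → ℝ)
    (hσ : ∀ t : ℕ, σ t =
      Real.sqrt β / (8 * L ^ 2 * Real.pi + 4 * β ^ 2) ^ (1 / 4 : ℝ) *
        DGS.rate d L τ β ^ ((t : ℝ) / 2) * r₀)
    (hx : ∀ t : ℕ, x (t + 1) = x t - (1 / (16 * L)) • DGS.dgsGrad M (σ t) ξ F (x t)) :
    0 < DGS.rate d L τ β ∧ DGS.rate d L τ β < 1 ∧
      (∀ t : ℕ, ‖x t - xstar‖ ^ 2 ≤ DGS.rate d L τ β ^ t * r₀ ^ 2) ∧
      Filter.Tendsto x Filter.atTop (nhds xstar) := by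

  have hd1 : (1 : ℝ) ≤ d := by exact_mod_cast hd
  have hd0 : (0 : ℝ) < d := by linarith
  have hπ := Real.pi_gt_d2
  have hπ' := Real.pi_lt_d2
  set Q := Real.sqrt (2 * L ^ 2 * Real.pi + β ^ 2) with hQ
  have hQL : 5 / 2 * L ≤ Q := Real.le_sqrt_of_sq_le (by nlinarith [sq_pos_of_pos hL])
  have hQ0 : 0 < Q := by linarith
  -- For `τ = 0` the smallness condition would bound a positive number by zero.
  have hτpos : 0 < τ := by
    refine hτ.lt_of_ne fun h => ?_
    rw [← h] at hβsmall
    norm_num at hβsmall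
    exact hβsmall.not_ge (by positivity)
  have : Nonempty (Fin d) := ⟨⟨0, hd⟩⟩
  have hτL : τ ≤ L := DGS.modulus_le hconv hLip
  have hconv' : ∀ x y, φ x + inner ℝ (gradient φ x) (y - x) ≤ φ y := fun x y =>
    (le_add_of_nonneg_right (by positivity)).trans (hconv x y)
  have hdβ : (48 * L + 3 * τ) * (d * (β * Q)) < Real.pi / 4 * (τ ^ 2 * L) := by
    have h := mul_lt_mul_of_pos_left hβsmall (by positivity : 0 < (48 * L + 3 * τ) * d)
    have h2 : (48 * L + 3 * τ) * d * (Real.pi / (32 * d) * (8 * τ ^ 2 * L / (48 * L + 3 * τ))) =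
        Real.pi / 4 * (τ ^ 2 * L) := by
      field_simp
      norm_num
    linarith
  have hβL : β ≤ L / 20 := by
    have h1 : 48 * L * (β * (5 / 2 * L)) ≤ (48 * L + 3 * τ) * (d * (β * Q)) := by
      have : β * (5 / 2 * L) ≤ d * (β * Q) := by
        calc β * (5 / 2 * L) ≤ 1 * (β * Q) := by rw [one_mul]; gcongr
          _ ≤ d * (β * Q) := by gcongr
      gcongr
      linarith
    have h2 : Real.pi / 4 * (τ ^ 2 * L) ≤ 1 * (L ^ 2 * L) := by gcongr; linarith
    have h3 : L ^ 2 * (120 * β) ≤ L ^ 2 * L := by linarith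
    have := le_of_mul_le_mul_left h3 (by positivity)
    linarith
  set ρ := DGS.rate d L τ β with hρdef
  have hρeq : ρ = 1 - τ / (32 * L) +
      (6 / (τ * L) + 3 / (8 * L ^ 2)) * (d * (β * Q) / Real.pi) := by
    rw [hρdef, DGS.rate, ← hQ, mul_assoc]
  have hρ0 : 0 < ρ := by
    have h1 : τ / (32 * L) ≤ 1 / 32 := by
      rw [div_le_div_iff₀ (by positivity) (by norm_num)]; linarith
    have h2 : 0 ≤ (6 / (τ * L) + 3 / (8 * L ^ 2)) * (d * (β * Q) / Real.pi) := by positivity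
    rw [hρeq]; linarith
  have hρ1 : ρ < 1 := by
    have h1 : (6 / (τ * L) + 3 / (8 * L ^ 2)) * (d * (β * Q) / Real.pi) =
        (48 * L + 3 * τ) * (d * (β * Q)) / (8 * τ * L ^ 2 * Real.pi) := by
      field_simp
      ring
    have h2 : (6 / (τ * L) + 3 / (8 * L ^ 2)) * (d * (β * Q) / Real.pi) < τ / (32 * L) := by
      rw [h1, div_lt_iff₀ (by positivity)]
      refine hdβ.trans_eq ?_
      field_simp
      norm_num
    rw [hρeq]; linarith
  have hσpos : ∀ t, 0 < σ t := fun t => by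
    rw [hσ]; positivity
  have hσsq : ∀ t, σ t ^ 2 * (2 * Q) = β * (ρ ^ t * r₀ ^ 2) := fun t => by
    have h1 : ((8 * L ^ 2 * Real.pi + 4 * β ^ 2) ^ (1 / 4 : ℝ)) ^ 2 = 2 * Q := by
      rw [← Real.rpow_natCast, ← Real.rpow_mul (by positivity),
        show (1 / 4 : ℝ) * (2 : ℕ) = 1 / 2 by norm_num, ← Real.sqrt_eq_rpow,
        show 8 * L ^ 2 * Real.pi + 4 * β ^ 2 = 2 ^ 2 * (2 * L ^ 2 * Real.pi + β ^ 2) by ring,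
        Real.sqrt_mul (by positivity), Real.sqrt_sq (by norm_num)]
    have h2 : (ρ ^ ((t : ℝ) / 2)) ^ 2 = ρ ^ t := by
      rw [← Real.rpow_natCast, ← Real.rpow_mul hρ0.le, ← Real.rpow_natCast]
      congr 1
      push_cast
      ring
    rw [hσ, mul_pow, mul_pow, div_pow, h1, h2, Real.sq_sqrt hβ.le]
    field_simp
  have hbound : ∀ t, ‖x t - xstar‖ ^ 2 ≤ ρ ^ t * r₀ ^ 2 := by
    intro t
    induction t with
    | zero => rw [pow_zero, one_mul]; gcongr
    | succ t ih =>
      have hr : √(ρ ^ t * r₀ ^ 2) ^ 2 = ρ ^ t * r₀ ^ 2 := Real.sq_sqrt (by positivity)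
      have herr := DGS.norm_dgsGrad_sub_sq_le (M := M) (σ := σ t) hξ fun i =>
        DGS.abs_ghDeriv_sub_inner_le hM2 hL hβ (hσpos t) hF hLip hconv' hε (x t) (hξ.1 i)
      have hE := DGS.error_sq_le (a := ‖x t - xstar‖) hL hβ hβL (hσpos t) hQL
        (by rw [hr, hσsq]) (by rw [hr]; exact ih)
      rw [hr] at hE
      -- The two terms leave slack factors `π / 10` and `π / 4`, both below one.
      have hcoef : 12 * (1 / (20 * τ * L) + 1 / (128 * L ^ 2)) ≤
          (6 / (τ * L) + 3 / (8 * L ^ 2)) / Real.pi := by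
        rw [le_div_iff₀ Real.pi_pos]
        have e : 12 * (1 / (20 * τ * L) + 1 / (128 * L ^ 2)) * Real.pi =
            Real.pi / 10 * (6 / (τ * L)) + Real.pi / 4 * (3 / (8 * L ^ 2)) := by
          field_simp
          ring
        rw [e]
        have p1 : 0 < 6 / (τ * L) := by positivity
        have p2 : 0 < 3 / (8 * L ^ 2) := by positivity
        nlinarith
      rw [hx]
      calc _ ≤ (1 - τ / (32 * L)) * ‖x t - xstar‖ ^ 2 +
            (1 / (20 * τ * L) + 1 / (128 * L ^ 2)) *
              ‖DGS.dgsGrad M (σ t) ξ F (x t) - gradient φ (x t)‖ ^ 2 :=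
            DGS.descent_step hL hτpos hLip hconv hmin _ _
        _ ≤ (1 - τ / (32 * L)) * (ρ ^ t * r₀ ^ 2) +
            (1 / (20 * τ * L) + 1 / (128 * L ^ 2)) *
              (d * (12 * (β * Q) * (ρ ^ t * r₀ ^ 2))) := by
            have h1 : 0 ≤ 1 - τ / (32 * L) := by
              rw [sub_nonneg, div_le_one (by positivity)]; linarith
            gcongr
            exact herr.trans (by gcongr)
        _ = (1 - τ / (32 * L)) * (ρ ^ t * r₀ ^ 2) +
            12 * (1 / (20 * τ * L) + 1 / (128 * L ^ 2)) *
              (d * (β * Q) * (ρ ^ t * r₀ ^ 2)) := by ring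
        _ ≤ (1 - τ / (32 * L)) * (ρ ^ t * r₀ ^ 2) +
            (6 / (τ * L) + 3 / (8 * L ^ 2)) / Real.pi * (d * (β * Q) * (ρ ^ t * r₀ ^ 2)) := by
            gcongr
        _ = ρ ^ (t + 1) * r₀ ^ 2 := by linear_combination (-(ρ ^ t * r₀ ^ 2)) * hρeq
  refine ⟨hρ0, hρ1, hbound, ?_⟩
  rw [tendsto_iff_norm_sub_tendsto_zero]
  have hlim : Filter.Tendsto (fun t : ℕ => √(ρ ^ t * r₀ ^ 2)) Filter.atTop (nhds 0) := by
    have := ((tendsto_pow_atTop_nhds_zero_of_lt_one hρ0.le hρ1).mul_const (r₀ ^ 2)).sqrt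
    simpa using this
  exact squeeze_zero (fun t => norm_nonneg _) (fun t => Real.le_sqrt_of_sq_le (hbound t)) hlim
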